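/- Let $n,d,d_0$ be nonnegative integers with $d\ge 2d_0-1$, and let $\boldsymbol x_1,\dots,\boldsymbol x_n\in\mathbb R^{d_0}$ satisfy $|\operatorname{supp}(\boldsymbol x_i)\cap\operatorname{supp}(\boldsymbol x_j)|\le 1$ for all $i\ne j$, where $\operatorname{supp}(\boldsymbol x):=\{r: x_r\neq 0\}$. For $\boldsymbol P\in\mathbb R^{d\times d_0}$ and $\boldsymbol x\in\mathbb R^{d_0}$ let $$f_{\mathrm{FM}}(\boldsymbol x;\boldsymbol P):=\sum_{1\le i<j\le d_0}(\boldsymbol P^{\mathrm T}\boldsymbol P)_{ij}\,x_i x_j$$ be the homogeneous factorization machine. Let $\ell_1,\dots,\ell_n:\mathbb R\to\mathbb R$ be locally Lipschitz and set $L(\boldsymbol P):=\sum_{k=1}^n \ell_k(f_{\mathrm{FM}}(\boldsymbol x_k;\boldsymbol P))$ on $\mathbb R^{d\times d_0}$, equipped with the Frobenius inner product. For a locally Lipschitz real function $f$ on a Euclidean space, the Clarke subdifferential $\partial_C f(z)$ is the convex hull of the set of all limits $\lim_m\nabla f(z_m)$ taken along sequences $z_m\to z$ of points at which $f$ is differentiable.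 Then for every $\boldsymbol P\in\mathbb R^{d\times d_0}$, $$\partial_C L(\boldsymbol P)=\sum_{k=1}^n\partial_C\ell_k\big(f_{\mathrm{FM}}(\boldsymbol x_k;\boldsymbol P)\big)\cdot\nabla_{\boldsymbol P}f_{\mathrm{FM}}(\boldsymbol x_k;\boldsymbol P),$$ where $A\cdot \boldsymbol G:=\{c\,\boldsymbol G: c\in A\}$ for $A\subseteq\mathbb R$, and the sum is the Minkowski sum of sets (the empty sum being $\{\boldsymbol 0\}$). -/

import Mathlib

open scoped Pointwise

/-- The set of all limits `lim ∇ f (y m)` along sequences `y m → x` of points at which `f` is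
differentiable, i.e. the Painlevé–Kuratowski outer limit of `{∇ f (y)}` as `y → x` within the set
of points of differentiability. -/
def limitingGradients {E : Type*} [NormedAddCommGroup E] [InnerProductSpace ℝ E] [CompleteSpace E]
    (f : E → ℝ) (x : E) : Set E :=
  {s | ∃ y : ℕ → E, Filter.Tendsto y Filter.atTop (nhds x) ∧
    (∀ m, DifferentiableAt ℝ f (y m)) ∧
    Filter.Tendsto (fun m => gradient f (y m)) Filter.atTop (nhds s)}

/-- The Clarke subdifferential of a (locally Lipschitz) real function on a Euclidean space:
the convex hull of the set of limiting gradients. -/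
def clarkeSubdifferential {E : Type*} [NormedAddCommGroup E] [InnerProductSpace ℝ E]
    [CompleteSpace E] (f : E → ℝ) (x : E) : Set E :=
  convexHull ℝ (limitingGradients f x)

/-- The space of real `d × d₀` matrices with the Frobenius inner product. -/
abbrev ParamSpace (d d₀ : ℕ) : Type := EuclideanSpace ℝ (Fin d × Fin d₀)

/-- A parameter, read as a `d × d₀` matrix. -/
def ParamSpace.toMatrix {d d₀ : ℕ} (P : ParamSpace d d₀) : Matrix (Fin d) (Fin d₀) ℝ :=
  Matrix.of fun r i => P (r, i)

/-- The homogeneous (second-order) factorization machine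
`f_FM(x; P) = ∑_{i < j} (Pᵀ P)_{ij} x_i x_j`. -/
def fmPredict {d d₀ : ℕ} (x : Fin d₀ → ℝ) (P : ParamSpace d d₀) : ℝ :=
  ∑ i : Fin d₀, ∑ j ∈ Finset.Ioi i, (P.toMatrix.transpose * P.toMatrix) i j * (x i * x j)

/-- The training loss `L(P) = ∑_k ℓ_k (f_FM(x_k; P))`. -/
def fmLoss {n d d₀ : ℕ} (x : Fin n → Fin d₀ → ℝ) (l : Fin n → ℝ → ℝ) (P : ParamSpace d d₀) : ℝ :=
  ∑ k : Fin n, l k (fmPredict (x k) P)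

/-! The inclusion "⊆" is a general chain rule. Near a point, chord slopes of a locally Lipschitz
function on the line lie almost in its Clarke interval (`clarkeSubdifferential_real`). This bounds
`inner s v`, for a limiting gradient `s` of the loss, by the support function of the Minkowski sum,
and Hahn-Banach puts `s` in that sum.

For "⊇", convex hulls commute with linear images and Minkowski sums, so it suffices to realise each
choice of limiting gradients of the `l k` by one sequence of parameters tending to `P`
(`sum_smul_gradient_mem_limitingGradients`). Distinct data points share no interaction pair, so all
predictions can be prescribed through the off-diagonal entries of `PᵀP`. To add a hollow symmetric
`A` there, subtract its least eigenvalue: `A - λI` is positive semidefinite of rank at most `d₀ -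
1`, hence a Gram matrix of small vectors orthogonal to the columns of `P`. There is room for them
because `d - d₀ ≥ d₀ - 1`. -/

/-! ### Limiting gradients: closedness and compactness. -/

theorem limitingGradients_eq_closure {E : Type*} [NormedAddCommGroup E] [InnerProductSpace ℝ E]
    [CompleteSpace E] (f : E → ℝ) (x : E) :
    limitingGradients f x =
      Prod.mk x ⁻¹' closure {p : E × E | DifferentiableAt ℝ f p.1 ∧ p.2 = gradient f p.1} := by
  ext s
  simp only [Set.mem_preimage, mem_closure_iff_seq_limit, limitingGradients, Set.mem_ofPred_eq]
  constructor
  · rintro ⟨y, hy, hd, hg⟩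
    exact ⟨fun m => (y m, gradient f (y m)), fun m => ⟨hd m, rfl⟩, hy.prodMk_nhds hg⟩
  · rintro ⟨p, hp, hlim⟩
    rw [Prod.tendsto_iff] at hlim
    refine ⟨fun m => (p m).1, hlim.1, fun m => (hp m).1, ?_⟩
    simpa only [← (hp _).2] using hlim.2

theorem isClosed_limitingGradients {E : Type*} [NormedAddCommGroup E] [InnerProductSpace ℝ E]
    [CompleteSpace E] (f : E → ℝ) (x : E) : IsClosed (limitingGradients f x) := by
  rw [limitingGradients_eq_closure]
  exact isClosed_closure.preimage (by fun_prop)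

theorem norm_gradient_le_of_lipschitzOn {E : Type*} [NormedAddCommGroup E] [InnerProductSpace ℝ E]
    [CompleteSpace E] {f : E → ℝ} {x : E} {s : Set E} {K : NNReal} (hs : s ∈ nhds x)
    (h : LipschitzOnWith K f s) : ‖gradient f x‖ ≤ K := by
  simpa [gradient] using norm_fderiv_le_of_lipschitzOn ℝ hs h

/-- Bounded gradients at points tending to `x` accumulate at a limiting gradient. -/
theorem exists_mem_limitingGradients {E : Type*} [NormedAddCommGroup E] [InnerProductSpace ℝ E]
    [FiniteDimensional ℝ E] [CompleteSpace E] {f : E → ℝ} (hf : LocallyLipschitz f) {x : E}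
    {C : Set E} (hC : IsClosed C)
    (h : ∃ᶠ y in nhds x, DifferentiableAt ℝ f y ∧ gradient f y ∈ C) :
    (limitingGradients f x ∩ C).Nonempty := by
  obtain ⟨K, t, ht, hK⟩ := hf x
  obtain ⟨y, hy, hyp⟩ := Filter.exists_seq_forall_of_frequently
    (h.and_eventually (eventually_mem_nhds_iff.2 ht))
  have hb : ∀ m, gradient f (y m) ∈ Metric.closedBall (0 : E) K := fun m => by
    simpa using norm_gradient_le_of_lipschitzOn (hyp m).2 hK
  obtain ⟨s, -, φ, hφ, hs⟩ := tendsto_subseq_of_bounded Metric.isBounded_closedBall hb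
  exact ⟨s, ⟨y ∘ φ, hy.comp hφ.tendsto_atTop, fun m => (hyp _).1.1, hs⟩,
    hC.mem_of_tendsto hs (Filter.Eventually.of_forall fun m => (hyp _).1.2)⟩

theorem limitingGradients_subset_closedBall {E : Type*} [NormedAddCommGroup E]
    [InnerProductSpace ℝ E] [CompleteSpace E] {f : E → ℝ} {x : E} {K : NNReal} {t : Set E}
    (ht : t ∈ nhds x) (hK : LipschitzOnWith K f t) :
    limitingGradients f x ⊆ Metric.closedBall 0 K := by
  rintro s ⟨y, hy, -, hs⟩
  refine Metric.isClosed_closedBall.mem_of_tendsto hs ?_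
  filter_upwards [hy.eventually (eventually_mem_nhds_iff.2 ht)] with m hm
  simpa using norm_gradient_le_of_lipschitzOn hm hK

theorem isCompact_limitingGradients {E : Type*} [NormedAddCommGroup E] [InnerProductSpace ℝ E]
    [FiniteDimensional ℝ E] [CompleteSpace E] {f : E → ℝ} (hf : LocallyLipschitz f) (x : E) :
    IsCompact (limitingGradients f x) := by
  obtain ⟨K, t, ht, hK⟩ := hf x
  exact (isCompact_closedBall _ _).of_isClosed_subset (isClosed_limitingGradients f x)
    (limitingGradients_subset_closedBall ht hK)

/-! ### Clarke subdifferentials on the real line. -/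

/-- A function that is Lipschitz on an interval is differentiable almost everywhere on it, and its
increment is controlled by bounds for the derivative. -/
theorem sub_mem_Icc_of_gradient_mem_Icc {f : ℝ → ℝ} {K : NNReal} {a b u w : ℝ} (huw : u ≤ w)
    (hf : LipschitzOnWith K f (Set.Icc u w))
    (h : ∀ y ∈ Set.Icc u w, DifferentiableAt ℝ f y → gradient f y ∈ Set.Icc a b) :
    f w - f u ∈ Set.Icc (a * (w - u)) (b * (w - u)) := by
  have hac : AbsolutelyContinuousOnInterval f u w :=
    LipschitzOnWith.absolutelyContinuousOnInterval (by rwa [Set.uIcc_of_le huw])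
  have hae : ∀ᵐ y ∂(MeasureTheory.volume.restrict (Set.Icc u w)), deriv f y ∈ Set.Icc a b := by
    rw [MeasureTheory.ae_restrict_iff' measurableSet_Icc]
    filter_upwards [hac.ae_differentiableAt] with y hy hmem
    have := h y hmem (hy (by rwa [Set.uIcc_of_le huw]))
    rwa [gradient_eq_deriv'] at this
  rw [← hac.integral_deriv_eq_sub]
  constructor
  · simpa [mul_comm] using intervalIntegral.integral_mono_ae_restrict huw
      (intervalIntegrable_const (c := a)) hac.intervalIntegrable_deriv
      (hae.mono fun y hy => hy.1)
  · simpa [mul_comm] using intervalIntegral.integral_mono_ae_restrict huw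
      hac.intervalIntegrable_deriv (intervalIntegrable_const (c := b))
      (hae.mono fun y hy => hy.2)

/-- On a short interval the function is absolutely continuous, so its points of nondifferentiability
are null and cannot fill an interval of positive length. -/
theorem frequently_differentiableAt_of_locallyLipschitz {f : ℝ → ℝ} (hf : LocallyLipschitz f)
    (t : ℝ) : ∃ᶠ y in nhds t, DifferentiableAt ℝ f y := by
  obtain ⟨K, s, hs, hK⟩ := hf t
  obtain ⟨δ, hδ, hball⟩ := Metric.mem_nhds_iff.1 hs
  rw [Metric.nhds_basis_ball.frequently_iff]
  intro ε hε
  have hr : 0 < min ε δ / 2 := by positivity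
  have hsub : Set.uIcc t (t + min ε δ / 2) ⊆ Metric.ball t (min ε δ) := by
    rw [Set.uIcc_of_le (by linarith)]
    intro y hy
    rw [Metric.mem_ball, Real.dist_eq, abs_of_nonneg (by linarith [hy.1])]
    linarith [hy.2]
  have hac : AbsolutelyContinuousOnInterval f t (t + min ε δ / 2) :=
    LipschitzOnWith.absolutelyContinuousOnInterval
      (hK.mono (hsub.trans ((Metric.ball_subset_ball (min_le_right _ _)).trans hball)))
  by_contra! hno
  have hnull : MeasureTheory.volume (Set.Icc t (t + min ε δ / 2)) = 0 := by
    refine MeasureTheory.measure_mono_null (fun y hy => ?_) hac.ae_differentiableAt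
    rw [← Set.uIcc_of_le (by linarith)] at hy
    simp only [Set.mem_compl_iff, Set.mem_ofPred_eq, Classical.not_imp]
    exact ⟨hy, hno y (Metric.ball_subset_ball (min_le_left _ _) (hsub hy))⟩
  simp only [Real.volume_Icc, ENNReal.ofReal_eq_zero] at hnull
  linarith

theorem limitingGradients_nonempty {f : ℝ → ℝ} (hf : LocallyLipschitz f) (t : ℝ) :
    (limitingGradients f t).Nonempty :=
  (exists_mem_limitingGradients hf isClosed_univ
    ((frequently_differentiableAt_of_locallyLipschitz hf t).mono fun _ hy => ⟨hy, trivial⟩)).mono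
    Set.inter_subset_left

theorem convexHull_eq_Icc_sInf_sSup {S : Set ℝ} (hS : IsCompact S) (hne : S.Nonempty) :
    convexHull ℝ S = Set.Icc (sInf S) (sSup S) := by
  apply Set.Subset.antisymm
  · exact convexHull_min
      (fun y hy => ⟨csInf_le hS.bddBelow hy, le_csSup hS.bddAbove hy⟩) (convex_Icc _ _)
  · rw [← segment_eq_Icc (csInf_le_csSup hne hS.bddBelow hS.bddAbove)]
    exact segment_subset_convexHull (hS.sInf_mem hne) (hS.sSup_mem hne)

/-- The Clarke subdifferential of a locally Lipschitz function on `ℝ` is a compact interval which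
controls the slopes of all nearby chords. -/
theorem clarkeSubdifferential_real {f : ℝ → ℝ} (hf : LocallyLipschitz f) (t : ℝ) :
    ∃ a b : ℝ, a ≤ b ∧ clarkeSubdifferential f t = Set.Icc a b ∧
      ∀ ε > 0, ∀ᶠ p : ℝ × ℝ in nhds (t, t),
        f p.2 - f p.1 ≤ max (a * (p.2 - p.1)) (b * (p.2 - p.1)) + ε * |p.2 - p.1| := by
  have hS := isCompact_limitingGradients hf t
  have hne := limitingGradients_nonempty hf t
  refine ⟨sInf (limitingGradients f t), sSup (limitingGradients f t),
    csInf_le_csSup hne hS.bddBelow hS.bddAbove,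
    convexHull_eq_Icc_sInf_sSup hS hne, fun ε hε => ?_⟩
  set a := sInf (limitingGradients f t)
  set b := sSup (limitingGradients f t)
  have hgrad : ∀ᶠ y in nhds t, DifferentiableAt ℝ f y →
      gradient f y ∈ Set.Icc (a - ε) (b + ε) := by
    by_contra hcon
    rw [Filter.not_eventually] at hcon
    -- Gradients outside the enlarged interval would accumulate at a limiting gradient in this
    -- closed set, hence outside `[a, b]`.
    obtain ⟨s, hs, hsC⟩ := exists_mem_limitingGradients hf
      (C := Set.Iic (a - ε) ∪ Set.Ici (b + ε)) (isClosed_Iic.union isClosed_Ici)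
      (hcon.mono fun y hy => by
        rw [Classical.not_imp] at hy
        refine ⟨hy.1, ?_⟩
        by_contra hn
        simp only [Set.mem_union, Set.mem_Iic, Set.mem_Ici, not_or, not_le] at hn
        exact hy.2 ⟨hn.1.le, hn.2.le⟩)
    have h1 : a ≤ s := csInf_le hS.bddBelow hs
    have h2 : s ≤ b := le_csSup hS.bddAbove hs
    rcases hsC with h | h <;> simp only [Set.mem_Iic, Set.mem_Ici] at h <;> linarith
  obtain ⟨K, s, hs, hK⟩ := hf t
  obtain ⟨δ, hδ, hball⟩ := Metric.mem_nhds_iff.1 (Filter.inter_mem hs hgrad)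
  have key : ∀ u w, u ∈ Metric.ball t δ → w ∈ Metric.ball t δ → u ≤ w →
      f w - f u ∈ Set.Icc ((a - ε) * (w - u)) ((b + ε) * (w - u)) := by
    intro u w hu hw huw
    have hsub : Set.Icc u w ⊆ Metric.ball t δ := by
      rw [Real.ball_eq_Ioo] at *
      exact fun y hy => ⟨hu.1.trans_le hy.1, hy.2.trans_lt hw.2⟩
    exact sub_mem_Icc_of_gradient_mem_Icc huw (hK.mono fun y hy => (hball (hsub hy)).1)
      fun y hy => (hball (hsub hy)).2
  filter_upwards [(Metric.isOpen_ball.prod Metric.isOpen_ball).mem_nhds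
    (Set.mk_mem_prod (Metric.mem_ball_self hδ) (Metric.mem_ball_self hδ))] with p hp
  rcases le_total p.1 p.2 with h | h
  · have := (key _ _ hp.1 hp.2 h).2
    rw [abs_of_nonneg (sub_nonneg.2 h)]
    linarith [le_max_right (a * (p.2 - p.1)) (b * (p.2 - p.1))]
  · have := (key _ _ hp.2 hp.1 h).1
    rw [abs_of_nonpos (sub_nonpos.2 h)]
    linarith [le_max_left (a * (p.2 - p.1)) (b * (p.2 - p.1))]

/-! ### Spectral bounds and perturbation of Gram matrices. -/

/-- Gershgorin with all discs centred at zero. It makes the Gram perturbation small when `A` is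
small. -/
theorem Matrix.IsHermitian.abs_eigenvalues_le_of_diag_eq_zero {ι : Type*} [Fintype ι]
    [DecidableEq ι] {A : Matrix ι ι ℝ} (hA : A.IsHermitian) (hdiag : ∀ i, A i i = 0) (i : ι) :
    |hA.eigenvalues i| ≤ ∑ j, ∑ k, |A j k| := by
  have hev : Module.End.HasEigenvalue (Matrix.toLin' A) (hA.eigenvalues i) := by
    refine Module.End.hasEigenvalue_of_hasEigenvector
      (x := ⇑(hA.eigenvectorBasis i)) ⟨?_, fun h => ?_⟩
    · rw [Module.End.mem_eigenspace_iff, Matrix.toLin'_apply, hA.mulVec_eigenvectorBasis]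
    · exact hA.eigenvectorBasis.toBasis.ne_zero i (by
        ext j
        simpa using congrFun h j)
  obtain ⟨k, hk⟩ := eigenvalue_mem_ball hev
  rw [Metric.mem_closedBall, hdiag, dist_zero_right, Real.norm_eq_abs] at hk
  calc |hA.eigenvalues i| ≤ ∑ j ∈ Finset.univ.erase k, |A k j| := hk
    _ ≤ ∑ j, |A k j| := Finset.sum_le_sum_of_subset_of_nonneg (Finset.erase_subset _ _)
        fun _ _ _ => abs_nonneg _
    _ ≤ _ := Finset.single_le_sum (f := fun j => ∑ k, |A j k|)
        (fun _ _ => Finset.sum_nonneg fun _ _ => abs_nonneg _) (Finset.mem_univ k)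

theorem Matrix.IsHermitian.sum_eigenvalues_mul {ι : Type*} [Fintype ι] [DecidableEq ι]
    {A : Matrix ι ι ℝ} (hA : A.IsHermitian) (j k : ι) :
    ∑ i, hA.eigenvalues i * (hA.eigenvectorBasis i j * hA.eigenvectorBasis i k) = A j k := by
  conv_rhs => rw [hA.spectral_theorem]
  simp [Unitary.conjStarAlgAut_apply, Matrix.mul_apply, Matrix.diagonal_apply,
    Matrix.star_apply]
  exact Finset.sum_congr rfl fun i _ => by ring

theorem OrthonormalBasis.sum_apply_mul_apply {ι : Type*} [Fintype ι] [DecidableEq ι]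
    (b : OrthonormalBasis ι ℝ (EuclideanSpace ℝ ι)) (j k : ι) :
    ∑ i, b i j * b i k = if j = k then 1 else 0 := by
  have := b.sum_inner_mul_inner (EuclideanSpace.single j (1 : ℝ)) (EuclideanSpace.single k 1)
  simpa [EuclideanSpace.inner_single_left, EuclideanSpace.inner_single_right, eq_comm] using this

/-- A subspace of codimension at most `m` contains an orthonormal family of the
complementary size. -/
theorem exists_orthonormal_orthogonal_span {m : ℕ} {V κ : Type*} [NormedAddCommGroup V]
    [InnerProductSpace ℝ V] [FiniteDimensional ℝ V] [Fintype κ] (p : Fin m → V)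
    (h : m + Fintype.card κ ≤ Module.finrank ℝ V) :
    ∃ w : κ → V, Orthonormal ℝ w ∧ ∀ i k, inner ℝ (p i) (w k) = 0 := by
  set S := Submodule.span ℝ (Set.range p)
  have hS : Module.finrank ℝ S ≤ m := by
    simpa [Set.finrank] using finrank_range_le_card (R := ℝ) p
  have hadd := S.finrank_add_finrank_orthogonal
  obtain ⟨e⟩ : Nonempty (κ ↪ Fin (Module.finrank ℝ Sᗮ)) :=
    Function.Embedding.nonempty_of_card_le (by simp; omega)
  have ho := ((stdOrthonormalBasis ℝ Sᗮ).orthonormal.comp e e.injective)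
  refine ⟨fun k => (stdOrthonormalBasis ℝ Sᗮ (e k) : V),
    ho.comp_linearIsometry Sᗮ.subtypeₗᵢ, fun i k => ?_⟩
  exact Submodule.inner_right_of_mem_orthogonal
    (Submodule.subset_span (Set.mem_range_self i)) (stdOrthonormalBasis ℝ Sᗮ (e k)).2

/-- The off-diagonal entries of a Gram matrix can be perturbed arbitrarily by a small change of
the vectors, provided that the ambient dimension is large enough. -/
theorem exists_gram_perturbation {m : ℕ} {V : Type*} [NormedAddCommGroup V]
    [InnerProductSpace ℝ V] [FiniteDimensional ℝ V] (hV : 2 * m ≤ Module.finrank ℝ V + 1)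
    (p : Fin m → V) {A : Matrix (Fin m) (Fin m) ℝ} (hA : A.IsHermitian)
    (hdiag : ∀ i, A i i = 0) :
    ∃ q : Fin m → V,
      (∀ j k, j ≠ k → inner ℝ (p j + q j) (p k + q k) = inner ℝ (p j) (p k) + A j k) ∧
      ∀ j, ‖q j‖ ^ 2 ≤ ∑ j, ∑ k, |A j k| := by
  rcases Nat.eq_zero_or_pos m with rfl | hm
  · exact ⟨0, fun j => j.elim0, fun j => j.elim0⟩
  have : Nonempty (Fin m) := ⟨⟨0, hm⟩⟩
  obtain ⟨i₀, hi₀⟩ := Finite.exists_min hA.eigenvalues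
  -- Omitting the least eigenvalue saves one dimension: only `m + (m - 1)` are needed, which is
  -- exactly `hV`.
  obtain ⟨w, hw, hpw⟩ := exists_orthonormal_orthogonal_span (κ := {i // i ≠ i₀}) p (by
    rw [Fintype.card_subtype_compl, Fintype.card_fin, Fintype.card_subtype_eq]; omega)
  set v := hA.eigenvectorBasis
  set lam := hA.eigenvalues
  -- A square root of `A - λ_min I`: its Gram matrix equals `A` off the diagonal, and `w ⟂ p` kills
  -- the cross terms.
  let q : Fin m → V := fun j => ∑ i : {i // i ≠ i₀}, (√(lam i - lam i₀) * v i j) • w i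
  have hpq : ∀ j k, inner ℝ (p j) (q k) = 0 := fun j k => by
    simp [q, inner_sum, inner_smul_right, hpw]
  have hqp : ∀ j k, inner ℝ (q j) (p k) = 0 := fun j k => by rw [real_inner_comm, hpq]
  have hqq : ∀ j k, inner ℝ (q j) (q k) = A j k - lam i₀ * if j = k then 1 else 0 := by
    intro j k
    rw [hw.inner_sum, ← hA.sum_eigenvalues_mul, ← v.sum_apply_mul_apply, Finset.mul_sum,
      ← Finset.sum_sub_distrib, ← Fintype.sum_subtype_add_sum_subtype (· ≠ i₀)]
    rw [Fintype.sum_eq_zero (fun i : {i // ¬ i ≠ i₀} => _), add_zero]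
    · refine Finset.sum_congr rfl fun i _ => ?_
      have := Real.mul_self_sqrt (sub_nonneg.2 (hi₀ i))
      simp only [conj_trivial]
      linear_combination (v i j * v i k) * this
    · rintro ⟨i, hi⟩
      rw [not_not] at hi
      subst hi
      exact sub_self _
  refine ⟨q, fun j k hjk => ?_, fun j => ?_⟩
  · rw [inner_add_left, inner_add_right, inner_add_right, hpq, hqp, hqq,
      if_neg hjk]
    ring
  · rw [← real_inner_self_eq_norm_sq, hqq, hdiag, if_pos rfl]
    have := hA.abs_eigenvalues_le_of_diag_eq_zero hdiag i₀
    linarith [neg_abs_le (lam i₀)]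

/-! ### The factorization machine and its prescribed predictions. -/

/-- The columns of a parameter matrix. -/
noncomputable def ParamSpace.col {d d₀ : ℕ} (P : ParamSpace d d₀) (i : Fin d₀) :
    EuclideanSpace ℝ (Fin d) :=
  WithLp.toLp 2 fun r => P (r, i)

theorem fmPredict_eq_sum_inner {d d₀ : ℕ} (x : Fin d₀ → ℝ) (P : ParamSpace d d₀) :
    fmPredict x P = ∑ i, ∑ j ∈ Finset.Ioi i, inner ℝ (P.col i) (P.col j) * (x i * x j) := by
  simp [fmPredict, ParamSpace.toMatrix, ParamSpace.col, Matrix.mul_apply, PiLp.inner_apply,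
    mul_comm]

theorem contDiff_fmPredict {d d₀ : ℕ} (x : Fin d₀ → ℝ) :
    ContDiff ℝ 1 (fmPredict x : ParamSpace d d₀ → ℝ) := by
  unfold fmPredict ParamSpace.toMatrix
  simp only [Matrix.mul_apply, Matrix.transpose_apply, Matrix.of_apply]
  fun_prop

theorem continuous_gradient_fmPredict {d d₀ : ℕ} (x : Fin d₀ → ℝ) :
    Continuous (gradient (fmPredict x : ParamSpace d d₀ → ℝ)) :=
  (InnerProductSpace.toDual ℝ _).symm.continuous.comp
    ((contDiff_fmPredict x).continuous_fderiv one_ne_zero)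

theorem hasGradientAt_fmPredict {d d₀ : ℕ} (x : Fin d₀ → ℝ) (P : ParamSpace d d₀) :
    HasGradientAt (fmPredict x) (gradient (fmPredict x) P) P :=
  ((contDiff_fmPredict x).differentiable one_ne_zero P).hasGradientAt

theorem fmPredict_eq_zero {d d₀ : ℕ} {x : Fin d₀ → ℝ}
    (h : ∑ i, ∑ j ∈ Finset.Ioi i, (x i * x j) ^ 2 = 0) (P : ParamSpace d d₀) :
    fmPredict x P = 0 := by
  rw [Finset.sum_eq_zero_iff_of_nonneg
    fun i _ => Finset.sum_nonneg fun j _ => sq_nonneg _] at h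
  refine Finset.sum_eq_zero fun i hi => Finset.sum_eq_zero fun j hj => ?_
  have := (Finset.sum_eq_zero_iff_of_nonneg fun j _ => sq_nonneg _).1 (h i hi) j hj
  rw [pow_eq_zero_iff two_ne_zero] at this
  rw [this, mul_zero]

theorem mul_mul_eq_zero_of_ncard_support_inter_le_one {ι : Type*} [Finite ι] {x y : ι → ℝ}
    (h : (Function.support x ∩ Function.support y).ncard ≤ 1) {i j : ι} (hij : i ≠ j) :
    x i * x j * (y i * y j) = 0 := by
  rw [Set.ncard_le_one_iff] at h
  by_contra hne
  simp only [mul_eq_zero, not_or] at hne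
  exact hij (h ⟨hne.1.1, hne.2.1⟩ ⟨hne.1.2, hne.2.2⟩)

/-- The predictions at all data points with a nontrivial interaction can be prescribed
independently by a small change of the parameter. -/
theorem exists_fmPredict_eq {n d d₀ : ℕ} (hd : 2 * d₀ ≤ d + 1) (x : Fin n → Fin d₀ → ℝ)
    (hx : ∀ i j : Fin n, i ≠ j →
      (Function.support (x i) ∩ Function.support (x j)).ncard ≤ 1)
    (P : ParamSpace d d₀) :
    ∃ g : (Fin n → ℝ) → ℝ, Continuous g ∧ g (fun k => fmPredict (x k) P) = 0 ∧
      ∀ τ : Fin n → ℝ, ∃ Q : ParamSpace d d₀, ‖Q - P‖ ^ 2 ≤ g τ ∧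
        ∀ k, ∑ i, ∑ j ∈ Finset.Ioi i, (x k i * x k j) ^ 2 ≠ 0 → fmPredict (x k) Q = τ k := by
  let N : Fin n → ℝ := fun k => ∑ i, ∑ j ∈ Finset.Ioi i, (x k i * x k j) ^ 2
  -- The off-diagonal parts of the `x k (x k)ᵀ` are mutually orthogonal, and dividing by `N k` moves
  -- prediction `k` by exactly `τ k - fmPredict (x k) P`. Terms with `N k = 0` vanish.
  let A : (Fin n → ℝ) → Matrix (Fin d₀) (Fin d₀) ℝ := fun τ => Matrix.of fun i j =>
    if i = j then 0 else ∑ k, (τ k - fmPredict (x k) P) / N k * (x k i * x k j)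
  have hAcont : ∀ i j, Continuous fun τ => A τ i j := fun i j => by
    by_cases h : i = j
    · simpa [A, h] using continuous_const
    · simp only [A, Matrix.of_apply, if_neg h]
      fun_prop
  refine ⟨fun τ => ∑ _i : Fin d₀, ∑ j, ∑ k, |A τ j k|, ?_, ?_, fun τ => ?_⟩
  · exact continuous_finsetSum _ fun _ _ => continuous_finsetSum _ fun j _ =>
      continuous_finsetSum _ fun k _ => (hAcont j k).abs
  · simp [A]
  have hherm : (A τ).IsHermitian := by
    ext i j
    simp only [A, Matrix.conjTranspose_apply, Matrix.of_apply, star_trivial, eq_comm (a := j),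
      mul_comm (x _ j)]
  obtain ⟨q, hq, hnorm⟩ := exists_gram_perturbation (by simpa using hd) P.col hherm
    fun i => by simp [A]
  let D : ParamSpace d d₀ := WithLp.toLp 2 fun p => q p.2 p.1
  refine ⟨P + D, ?_, fun k hk => ?_⟩
  · rw [add_sub_cancel_left, EuclideanSpace.norm_sq_eq, Fintype.sum_prod_type_right]
    refine Finset.sum_le_sum fun j _ => (le_of_eq ?_).trans (hnorm j)
    rw [EuclideanSpace.norm_sq_eq]
  · have hcol : ∀ i, (P + D).col i = P.col i + q i := fun i => rfl
    have hsum : fmPredict (x k) (P + D) = fmPredict (x k) P +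
        ∑ k', (τ k' - fmPredict (x k') P) / N k' *
          ∑ i, ∑ j ∈ Finset.Ioi i, x k' i * x k' j * (x k i * x k j) := by
      rw [fmPredict_eq_sum_inner, fmPredict_eq_sum_inner]
      simp_rw [Finset.mul_sum]
      rw [Finset.sum_comm, ← Finset.sum_add_distrib]
      refine Finset.sum_congr rfl fun i _ => ?_
      rw [Finset.sum_comm, ← Finset.sum_add_distrib]
      refine Finset.sum_congr rfl fun j hj => ?_
      have hij : i ≠ j := (Finset.mem_Ioi.1 hj).ne
      rw [hcol, hcol, hq i j hij, add_mul]
      simp only [A, Matrix.of_apply, if_neg hij, Finset.sum_mul, mul_assoc]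
    rw [hsum, Finset.sum_eq_single k]
    · have : ∑ i, ∑ j ∈ Finset.Ioi i, x k i * x k j * (x k i * x k j) = N k := by
        simp only [N, sq]
      rw [this, div_mul_cancel₀ _ hk]
      ring
    · intro k' _ hk'
      rw [Finset.sum_eq_zero fun i _ => Finset.sum_eq_zero fun j hj =>
        mul_mul_eq_zero_of_ncard_support_inter_le_one (hx k' k hk') (Finset.mem_Ioi.1 hj).ne,
        mul_zero]
    · simp

/-! ### Chain rules and the two inclusions. -/

theorem HasGradientAt.real_comp {E : Type*} [NormedAddCommGroup E] [InnerProductSpace ℝ E]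
    [CompleteSpace E] {f : E → ℝ} {f' x : E} {g : ℝ → ℝ} {g' : ℝ} (hg : HasDerivAt g g' (f x))
    (hf : HasGradientAt f f' x) : HasGradientAt (fun y => g (f y)) (g' • f') x := by
  rw [hasGradientAt_iff_hasFDerivAt] at *
  simpa [Function.comp_def] using! hg.comp_hasFDerivAt x hf

theorem HasGradientAt.fun_sum {ι E : Type*} [NormedAddCommGroup E] [InnerProductSpace ℝ E]
    [CompleteSpace E] {s : Finset ι} {f : ι → E → ℝ} {f' : ι → E} {x : E}
    (hf : ∀ k ∈ s, HasGradientAt (f k) (f' k) x) :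
    HasGradientAt (fun y => ∑ k ∈ s, f k y) (∑ k ∈ s, f' k) x := by
  simp only [hasGradientAt_iff_hasFDerivAt] at *
  simpa using HasFDerivAt.fun_sum hf

/-- Every choice of limiting gradients of the losses gives a limiting gradient of the total
loss. -/
theorem sum_smul_gradient_mem_limitingGradients {n d d₀ : ℕ} (hd : 2 * d₀ ≤ d + 1)
    (x : Fin n → Fin d₀ → ℝ)
    (hx : ∀ i j : Fin n, i ≠ j →
      (Function.support (x i) ∩ Function.support (x j)).ncard ≤ 1)
    (l : Fin n → ℝ → ℝ) (P : ParamSpace d d₀) {c : Fin n → ℝ}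
    (hc : ∀ k, c k ∈ limitingGradients (l k) (fmPredict (x k) P)) :
    ∑ k, c k • gradient (fmPredict (x k)) P ∈ limitingGradients (fmLoss x l) P := by
  choose y hy hyd hyg using hc
  obtain ⟨g, hgc, hg0, hg⟩ := exists_fmPredict_eq hd x hx P
  choose Q hQ hQeq using hg
  have hQP : Filter.Tendsto (fun m => Q fun k => y k m) Filter.atTop (nhds P) := by
    have hlim : Filter.Tendsto (fun m => g fun k => y k m) Filter.atTop (nhds 0) := by
      rw [← hg0]
      exact (hgc.tendsto _).comp (tendsto_pi_nhds.2 hy)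
    rw [tendsto_iff_norm_sub_tendsto_zero]
    have hsq := (squeeze_zero (fun m => sq_nonneg _) (fun m => hQ fun k => y k m) hlim).sqrt
    simpa using hsq
  have hgrad : ∀ m, HasGradientAt (fmLoss x l)
      (∑ k, gradient (l k) (y k m) • gradient (fmPredict (x k)) (Q fun k => y k m))
      (Q fun k => y k m) := by
    refine fun m => HasGradientAt.fun_sum fun k _ => ?_
    -- Without interactions `Q` need not hit `y k m`, but then the prediction is identically zero
    -- and contributes no gradient.
    by_cases hk : ∑ i, ∑ j ∈ Finset.Ioi i, (x k i * x k j) ^ 2 = 0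
    · have hzero : (fmPredict (x k) : ParamSpace d d₀ → ℝ) = fun _ => 0 :=
        funext (fmPredict_eq_zero hk)
      simpa [hzero] using hasGradientAt_const (F := ParamSpace d d₀) _ (l k 0)
    · refine HasGradientAt.real_comp ?_ (hasGradientAt_fmPredict _ _)
      rw [hQeq _ k hk, gradient_eq_deriv']
      exact (hyd k m).hasDerivAt
  refine ⟨fun m => Q fun k => y k m, hQP, fun m => (hgrad m).differentiableAt, ?_⟩
  simp only [fun m => (hgrad m).gradient]
  exact tendsto_finsetSum _ fun k _ => (hyg k).smul
    (((continuous_gradient_fmPredict (x k)).tendsto P).comp hQP)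

/-- Directional form of the subdifferential chain and sum rule. -/
theorem inner_le_of_mem_limitingGradients {ι E : Type*} [Fintype ι] [NormedAddCommGroup E]
    [InnerProductSpace ℝ E] [CompleteSpace E] {l : ι → ℝ → ℝ} {f : ι → E → ℝ}
    (hf : ∀ k, Differentiable ℝ (f k)) (hg : ∀ k, Continuous (gradient (f k))) {x : E}
    {a b : ι → ℝ}
    (hab : ∀ k, ∀ ε > 0, ∀ᶠ p : ℝ × ℝ in nhds (f k x, f k x), l k p.2 - l k p.1 ≤
      max (a k * (p.2 - p.1)) (b k * (p.2 - p.1)) + ε * |p.2 - p.1|)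
    {s : E} (hs : s ∈ limitingGradients (fun y => ∑ k, l k (f k y)) x) (v : E) :
    inner ℝ s v ≤ ∑ k, max (a k * inner ℝ (gradient (f k) x) v)
      (b k * inner ℝ (gradient (f k) x) v) := by
  obtain ⟨y, hy, hyd, hyg⟩ := hs
  have hbound : ∀ ε > 0, ∀ᶠ z in nhds x, DifferentiableAt ℝ (fun y => ∑ k, l k (f k y)) z →
      inner ℝ (gradient (fun y => ∑ k, l k (f k y)) z) v ≤
        ∑ k, (max (a k * inner ℝ (gradient (f k) z) v) (b k * inner ℝ (gradient (f k) z) v)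
          + ε * |inner ℝ (gradient (f k) z) v|) := by
    intro ε hε
    -- The chord bound must hold around `f k z` for each nearby `z`, so that directional derivatives
    -- can be taken at `z` itself.
    have hev : ∀ᶠ z in nhds x, ∀ k, ∀ᶠ p : ℝ × ℝ in nhds (f k z, f k z), l k p.2 - l k p.1 ≤
        max (a k * (p.2 - p.1)) (b k * (p.2 - p.1)) + ε * |p.2 - p.1| := by
      rw [Filter.eventually_all]
      intro k
      have hcont : Filter.Tendsto (fun z => (f k z, f k z)) (nhds x) (nhds (f k x, f k x)) :=
        (((hf k).continuous.prodMk (hf k).continuous).tendsto x)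
      exact hcont.eventually (eventually_eventually_nhds.2 (hab k ε hε))
    filter_upwards [hev] with z hz hdz
    have hline : ∀ {h : E → ℝ}, DifferentiableAt ℝ h z →
        Filter.Tendsto (fun t : ℝ => t⁻¹ * (h (z + t • v) - h z)) (nhdsWithin 0 (Set.Ioi 0))
          (nhds (inner ℝ (gradient h z) v)) := by
      intro h hh
      rw [inner_gradient_left]
      simpa using (hh.hasFDerivAt.hasLineDerivAt v).tendsto_slope_zero_right
    refine le_of_tendsto_of_tendsto (hline hdz) (tendsto_finsetSum _ fun k _ =>
      (((hline (hf k z)).const_mul (a k)).max ((hline (hf k z)).const_mul (b k))).add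
        ((hline (hf k z)).abs.const_mul ε)) ?_
    have hz' : ∀ᶠ t : ℝ in nhdsWithin 0 (Set.Ioi 0), ∀ k,
        l k (f k (z + t • v)) - l k (f k z) ≤
          max (a k * (f k (z + t • v) - f k z)) (b k * (f k (z + t • v) - f k z))
            + ε * |f k (z + t • v) - f k z| := by
      rw [Filter.eventually_all]
      intro k
      have hcont : Filter.Tendsto (fun t : ℝ => (f k z, f k (z + t • v)))
          (nhdsWithin 0 (Set.Ioi 0)) (nhds (f k z, f k z)) := by
        have hc : Continuous fun t : ℝ => (f k z, f k (z + t • v)) :=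
          continuous_const.prodMk ((hf k).continuous.comp (by fun_prop))
        have := (hc.tendsto 0).mono_left (nhdsWithin_le_nhds (s := Set.Ioi 0))
        simpa using this
      exact hcont.eventually (hz k)
    filter_upwards [hz', self_mem_nhdsWithin] with t ht (ht0 : 0 < t)
    rw [← Finset.sum_sub_distrib, Finset.mul_sum]
    refine Finset.sum_le_sum fun k _ => ?_
    have hpos : 0 ≤ t⁻¹ := (inv_pos.2 ht0).le
    refine (mul_le_mul_of_nonneg_left (ht k) hpos).trans_eq ?_
    rw [mul_add, mul_max_of_nonneg _ _ hpos, abs_mul, abs_of_nonneg hpos, mul_left_comm _ (a k),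
      mul_left_comm _ (b k), mul_left_comm _ ε]
  have hlim : ∀ k, Filter.Tendsto (fun m => inner ℝ (gradient (f k) (y m)) v) Filter.atTop
      (nhds (inner ℝ (gradient (f k) x) v)) := fun k =>
    (((hg k).tendsto x).comp hy).inner tendsto_const_nhds
  have hle : ∀ ε > 0, inner ℝ s v ≤
      ∑ k, (max (a k * inner ℝ (gradient (f k) x) v) (b k * inner ℝ (gradient (f k) x) v)
          + ε * |inner ℝ (gradient (f k) x) v|) := fun ε hε =>
    le_of_tendsto_of_tendsto (hyg.inner tendsto_const_nhds)
      (tendsto_finsetSum _ fun k _ => (((hlim k).const_mul (a k)).max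
        ((hlim k).const_mul (b k))).add ((hlim k).abs.const_mul ε))
      ((hy.eventually (hbound ε hε)).mono fun m hm => hm (hyd m))
  have hcont : Continuous fun ε : ℝ =>
      ∑ k, (max (a k * inner ℝ (gradient (f k) x) v) (b k * inner ℝ (gradient (f k) x) v)
          + ε * |inner ℝ (gradient (f k) x) v|) := by fun_prop
  have hzero := (hcont.tendsto 0).mono_left (nhdsWithin_le_nhds (s := Set.Ioi 0))
  simp only [zero_mul, add_zero] at hzero
  exact ge_of_tendsto hzero (Filter.eventually_of_mem self_mem_nhdsWithin hle)

/-- Subdifferential chain and sum rule for locally Lipschitz functions composed with continuously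
differentiable inner functions. -/
theorem limitingGradients_sum_comp_subset {ι E : Type*} [Fintype ι] [NormedAddCommGroup E]
    [InnerProductSpace ℝ E] [CompleteSpace E] {l : ι → ℝ → ℝ} (hl : ∀ k, LocallyLipschitz (l k))
    {f : ι → E → ℝ} (hf : ∀ k, Differentiable ℝ (f k)) (hg : ∀ k, Continuous (gradient (f k)))
    (x : E) :
    limitingGradients (fun y => ∑ k, l k (f k y)) x ⊆
      {s | ∃ c : ι → ℝ, (∀ k, c k ∈ clarkeSubdifferential (l k) (f k x)) ∧
        ∑ k, c k • gradient (f k) x = s} := by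
  intro s hs
  choose a b hab hclarke hchord using fun k => clarkeSubdifferential_real (hl k) (f k x)
  let Φ : (ι → ℝ) →ₗ[ℝ] E := Fintype.linearCombination ℝ fun k => gradient (f k) x
  have hΦ : ∀ c, Φ c = ∑ k, c k • gradient (f k) x := fun c =>
    Fintype.linearCombination_apply ℝ _ c
  have hΦc : Continuous Φ := Φ.continuous_of_finiteDimensional
  have hK : s ∈ Φ '' Set.Icc a b := by
    by_contra hs'
    obtain ⟨φ, u, hu, hus⟩ := geometric_hahn_banach_closed_point
      ((convex_Icc a b).linear_image Φ) (isCompact_Icc.image hΦc).isClosed hs'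
    have hφ : ∀ y, φ y = inner ℝ y ((InnerProductSpace.toDual ℝ E).symm φ) := fun y => by
      rw [real_inner_comm, InnerProductSpace.toDual_symm_apply]
    have hle := inner_le_of_mem_limitingGradients hf hg hchord hs
      ((InnerProductSpace.toDual ℝ E).symm φ)
    simp only [← hφ] at hle
    -- The vertex of the box maximising `φ ∘ Φ`; its value is the bound `hle`, contradicting strict
    -- separation.
    let c : ι → ℝ := fun k => if a k * φ (gradient (f k) x) ≤ b k * φ (gradient (f k) x)
      then b k else a k
    have hc : c ∈ Set.Icc a b := by
      constructor <;> intro k <;> simp only [c] <;> split_ifs <;> simp [hab k]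
    have hsum : φ (Φ c) = ∑ k, max (a k * φ (gradient (f k) x)) (b k * φ (gradient (f k) x)) := by
      rw [hΦ, map_sum]
      refine Finset.sum_congr rfl fun k _ => ?_
      simp only [map_smul, smul_eq_mul, c]
      split_ifs with h
      · rw [max_eq_right h]
      · rw [max_eq_left (not_le.1 h).le]
    have := hu _ (Set.mem_image_of_mem Φ hc)
    linarith
  obtain ⟨c, hc, rfl⟩ := hK
  refine ⟨c, fun k => ?_, (hΦ c).symm⟩
  rw [hclarke]
  exact ⟨hc.1 k, hc.2 k⟩

theorem mainTheorem8 (n d d₀ : ℕ) (hd : 2 * d₀ ≤ d + 1)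
    (x : Fin n → Fin d₀ → ℝ)
    (hx : ∀ i j : Fin n, i ≠ j →
      (Function.support (x i) ∩ Function.support (x j)).ncard ≤ 1)
    (l : Fin n → ℝ → ℝ) (hl : ∀ k, LocallyLipschitz (l k))
    (P : ParamSpace d d₀) :
    clarkeSubdifferential (fmLoss x l) P =
      ∑ k : Fin n, (fun c : ℝ => c • gradient (fmPredict (x k)) P) ''
        clarkeSubdifferential (l k) (fmPredict (x k) P) := by
  have himage : ∀ k, (fun c : ℝ => c • gradient (fmPredict (x k)) P) ''
      clarkeSubdifferential (l k) (fmPredict (x k) P) =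
      convexHull ℝ ((fun c : ℝ => c • gradient (fmPredict (x k)) P) ''
        limitingGradients (l k) (fmPredict (x k) P)) := fun k =>
    (LinearMap.toSpanSingleton ℝ _ (gradient (fmPredict (x k)) P)).image_convexHull _
  apply Set.Subset.antisymm
  · refine convexHull_min (fun s hs => ?_) (convex_sum _ fun k _ => ?_)
    · obtain ⟨c, hc, rfl⟩ := limitingGradients_sum_comp_subset hl
        (fun k => (contDiff_fmPredict (x k)).differentiable one_ne_zero)
        (fun k => continuous_gradient_fmPredict (x k)) P hs
      exact Set.finsetSum_mem_finsetSum _ _ _ fun k _ => Set.mem_image_of_mem _ (hc k)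
    · rw [himage]
      exact convex_convexHull _ _
  · simp only [himage]
    rw [← convexHull_sum]
    refine convexHull_mono fun s hs => ?_
    obtain ⟨g, hg, rfl⟩ := (Set.mem_fintype_sum _ _).1 hs
    choose c hc hcg using hg
    simp only [← hcg]
    exact sum_smul_gradient_mem_limitingGradients hd x hx l P hc
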